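/- Let $K$ be a field and let $E=(E^0,E^1,r,s)$ be a row-finite directed graph (every vertex emits only finitely many edges; $E^0$ and $E^1$ may be infinite). Write $u\ge v$ if there is a directed path (possibly of length $0$) from $u$ to $v$, and, for $H\subseteq E^0$, write $u\ge H$ if $u\ge v$ for some $v\in H$. A set $H\subseteq E^0$ is hereditary if $v\in H$ and $v\ge w$ imply $w\in H$. It is saturated if every vertex $v$ with $s^{-1}(v)$ finite and nonempty and $r(s^{-1}(v))\subseteq H$ belongs to $H$. The Leavitt path algebra $L_K(E)$ is the associative (not necessarily unital) $K$-algebra generated by the symbols $v\in E^0$ and $e,e^*$ ($e\in E^1$) subject to the relations $vw=\delta_{v,w}v$, $\;s(e)e=e=e\,r(e)$, $\;r(e)e^*=e^*=e^*s(e)$, $\;e^*f=\delta_{e,f}\,r(e)$ for all $v,w\in E^0$ and $e,f\in E^1$, and $v=\sum_{s(e)=v}ee^*$ for every $v\in E^0$ with $s^{-1}(v)$ finite and nonempty. For $X\subseteq E^0$ let $I(X)$ be the two-sided ideal of $L_K(E)$ generated by $X$, and for a two-sided ideal $I$ let $\mathrm{Ann}(I)=\{a\in L_K(E): aI=Ia=0\}$.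 Let $H\subseteq E^0$ be hereditary and saturated, and let $H'=\{v\in E^0 : v\not\ge H\}$. Then: 1. $H'$ is hereditary and saturated; 2. $\mathrm{Ann}(I(H))=I(H')$. -/

import Mathlib

universe u v w

/-- A directed graph `(E⁰, E¹, r, s)` with vertex set `V` and edge set `E`; loops, parallel edges
and infinite vertex or edge sets are allowed. -/
structure DirectedGraph (V : Type u) (E : Type v) where
  /-- the source of an edge -/
  s : E → V
  /-- the range of an edge -/
  r : E → V

namespace DirectedGraph

variable {V : Type u} {E : Type v} (G : DirectedGraph V E)

/-- Row-finite: every vertex emits finitely many edges. -/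
def RowFinite : Prop :=
  ∀ v : V, {e : E | G.s e = v}.Finite

/-- A regular vertex: neither a sink nor an infinite emitter. -/
def IsRegular (v : V) : Prop :=
  {e : E | G.s e = v}.Finite ∧ {e : E | G.s e = v}.Nonempty

/-- `u ≥ v`: there is a (possibly trivial) directed path from `u` to `v`. -/
def Reaches (u v : V) : Prop :=
  Relation.ReflTransGen (fun a b : V => ∃ e : E, G.s e = a ∧ G.r e = b) u v

/-- `u ≥ H`: there is a (possibly trivial) directed path from `u` to some vertex of `H`. -/
def ConnectsTo (u : V) (H : Set V) : Prop :=
  ∃ v ∈ H, G.Reaches u v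

/-- Hereditary sets of vertices. -/
def Hereditary (H : Set V) : Prop :=
  ∀ v ∈ H, ∀ w : V, G.Reaches v w → w ∈ H

/-- Saturated sets of vertices. -/
def Saturated (X : Set V) : Prop :=
  ∀ v : V, G.IsRegular v → (∀ e : E, G.s e = v → G.r e ∈ X) → v ∈ X

/-- The set `H'` of all vertices that do not connect to `H`. -/
def notConnecting (H : Set V) : Set V :=
  {v : V | ¬ G.ConnectsTo v H}

end DirectedGraph

/-- The generators of a Leavitt path algebra: vertices, edges, and ghost edges `e*`. -/
inductive LeavittGen (V : Type u) (E : Type v) : Type (max u v)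
  | vertex (v : V) : LeavittGen V E
  | edge (e : E) : LeavittGen V E
  | ghost (e : E) : LeavittGen V E

/-- The free associative (not necessarily unital) `K`-algebra on the generators: the semigroup
algebra of the free semigroup. -/
abbrev LeavittFree (K : Type w) [Field K] (V : Type u) (E : Type v) : Type (max u v w) :=
  MonoidAlgebra K (FreeSemigroup (LeavittGen V E))

namespace LeavittFree

variable (K : Type w) [Field K] {V : Type u} {E : Type v}

/-- A generator, as an element of the free algebra. -/
noncomputable def gen (x : LeavittGen V E) : LeavittFree K V E :=
  MonoidAlgebra.single (FreeSemigroup.of x) 1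

/-- The vertex `v`, as an element of the free algebra. -/
noncomputable def vertex (v : V) : LeavittFree K V E := gen K (LeavittGen.vertex v)

/-- The edge `e`, as an element of the free algebra. -/
noncomputable def edge (e : E) : LeavittFree K V E := gen K (LeavittGen.edge e)

/-- The ghost edge `e*`, as an element of the free algebra. -/
noncomputable def ghost (e : E) : LeavittFree K V E := gen K (LeavittGen.ghost e)

end LeavittFree

open LeavittFree in
/-- The defining relations (V), (E1), (E2), (CK1), (CK2) of the Leavitt path algebra. -/
inductive LeavittRel (K : Type w) [Field K] {V : Type u} {E : Type v} (G : DirectedGraph V E) :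
    LeavittFree K V E → LeavittFree K V E → Prop
  | vertex_mul_self (v : V) : LeavittRel K G (vertex K v * vertex K v) (vertex K v)
  | vertex_mul_of_ne (v w : V) (h : v ≠ w) : LeavittRel K G (vertex K v * vertex K w) 0
  | source_mul_edge (e : E) : LeavittRel K G (vertex K (G.s e) * edge K e) (edge K e)
  | edge_mul_range (e : E) : LeavittRel K G (edge K e * vertex K (G.r e)) (edge K e)
  | range_mul_ghost (e : E) : LeavittRel K G (vertex K (G.r e) * ghost K e) (ghost K e)
  | ghost_mul_source (e : E) : LeavittRel K G (ghost K e * vertex K (G.s e)) (ghost K e)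
  | ghost_mul_edge_self (e : E) : LeavittRel K G (ghost K e * edge K e) (vertex K (G.r e))
  | ghost_mul_edge_of_ne (e f : E) (h : e ≠ f) : LeavittRel K G (ghost K e * edge K f) 0
  /-- For a regular vertex `v`, where `t` is the (finite, nonempty) set of edges emitted by `v`. -/
  | sum_edge_mul_ghost (v : V) (t : Finset E) (ht : ∀ e : E, e ∈ t ↔ G.s e = v)
      (hne : t.Nonempty) : LeavittRel K G (∑ e ∈ t, edge K e * ghost K e) (vertex K v)

/-- The algebra congruence generated by the defining relations. Since the free algebra has no unit,
closure under scalars is put in by hand: the ring congruence is generated by all scalar multiples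
of the defining relations. -/
noncomputable def leavittCon (K : Type w) [Field K] {V : Type u} {E : Type v} (G : DirectedGraph V E) :
    RingCon (LeavittFree K V E) :=
  ringConGen fun x y => ∃ (c : K) (a b : LeavittFree K V E),
    LeavittRel K G a b ∧ x = c • a ∧ y = c • b

theorem leavittCon_smul (K : Type w) [Field K] {V : Type u} {E : Type v} (G : DirectedGraph V E)
    (c : K) {x y : LeavittFree K V E} (h : leavittCon K G x y) :
    leavittCon K G (c • x) (c • y) := by
  have h' : RingConGen.Rel (fun x y => ∃ (c : K) (a b : LeavittFree K V E),
    LeavittRel K G a b ∧ x = c • a ∧ y = c • b) x y := h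
  clear h
  induction h' with
  | of x y h =>
    obtain ⟨d, a, b, hab, rfl, rfl⟩ := h
    exact RingConGen.Rel.of _ _ ⟨c * d, a, b, hab, by rw [mul_smul], by rw [mul_smul]⟩
  | refl x => exact (leavittCon K G).refl _
  | symm _ ih => exact (leavittCon K G).symm ih
  | trans _ _ ih₁ ih₂ => exact (leavittCon K G).trans ih₁ ih₂
  | add _ _ ih₁ ih₂ =>
    rw [smul_add, smul_add]
    exact (leavittCon K G).add ih₁ ih₂
  | @mul w x y z _ hyz ih₁ _ =>
    rw [← smul_mul_assoc, ← smul_mul_assoc]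
    exact (leavittCon K G).mul ih₁ hyz

/-- The Leavitt path algebra `L_K(E)`: the associative `K`-algebra, unital only if there are
finitely many vertices, generated by vertices, edges and ghost edges subject to the defining
relations. -/
def LeavittPathAlgebra (K : Type w) [Field K] {V : Type u} {E : Type v} (G : DirectedGraph V E) :
    Type (max u v w) :=
  (leavittCon K G).Quotient

namespace LeavittPathAlgebra

variable (K : Type w) [Field K] {V : Type u} {E : Type v} (G : DirectedGraph V E)

noncomputable instance : NonUnitalRing (LeavittPathAlgebra K G) :=
  inferInstanceAs (NonUnitalRing (leavittCon K G).Quotient)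

/-- The projection from the free algebra. -/
noncomputable def mk (x : LeavittFree K V E) : LeavittPathAlgebra K G :=
  (leavittCon K G).toQuotient x

noncomputable instance : SMul K (LeavittPathAlgebra K G) where
  smul c := Quotient.map' (fun x => c • x) fun _ _ h => leavittCon_smul K G c h

noncomputable instance : Module K (LeavittPathAlgebra K G) where
  one_smul x := by
    induction x using Quotient.inductionOn' with
    | h x => exact congrArg (mk K G) (one_smul K x)
  mul_smul a b x := by
    induction x using Quotient.inductionOn' with
    | h x => exact congrArg (mk K G) (mul_smul a b x)
  smul_zero a := congrArg (mk K G) (smul_zero a)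
  smul_add a x y := by
    induction x using Quotient.inductionOn' with
    | h x =>
      induction y using Quotient.inductionOn' with
      | h y => exact congrArg (mk K G) (smul_add a x y)
  add_smul a b x := by
    induction x using Quotient.inductionOn' with
    | h x => exact congrArg (mk K G) (add_smul a b x)
  zero_smul x := by
    induction x using Quotient.inductionOn' with
    | h x => exact congrArg (mk K G) (zero_smul K x)

instance : IsScalarTower K (LeavittPathAlgebra K G) (LeavittPathAlgebra K G) where
  smul_assoc a x y := by
    induction x using Quotient.inductionOn' with
    | h x =>
      induction y using Quotient.inductionOn' with
      | h y => exact congrArg (mk K G) (smul_mul_assoc a x y)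

instance : SMulCommClass K (LeavittPathAlgebra K G) (LeavittPathAlgebra K G) where
  smul_comm a x y := by
    induction x using Quotient.inductionOn' with
    | h x =>
      induction y using Quotient.inductionOn' with
      | h y => exact congrArg (mk K G) (mul_smul_comm a x y).symm

/-- The vertex `v`, as an element of `L_K(E)`. -/
noncomputable def vertex (v : V) : LeavittPathAlgebra K G := mk K G (LeavittFree.vertex K v)

/-- `I(H)`: the two-sided ideal of `L_K(E)` generated by the vertices in `H`. As `L_K(E)` has local
units (finite sums of vertices), its ring ideals are the same as its algebra ideals. -/
noncomputable def idealOf (H : Set V) : TwoSidedIdeal (LeavittPathAlgebra K G) :=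
  TwoSidedIdeal.span (vertex K G '' H)

end LeavittPathAlgebra

/-- The annihilator `Ann(I) = {a ∈ A : aI = Ia = 0}` of a two-sided ideal, itself a two-sided
ideal. -/
def TwoSidedIdeal.ann {A : Type u} [NonUnitalRing A] (I : TwoSidedIdeal A) : TwoSidedIdeal A :=
  TwoSidedIdeal.mk' {a : A | ∀ x ∈ I, a * x = 0 ∧ x * a = 0}
    (fun x _ => ⟨zero_mul x, mul_zero x⟩)
    (fun {a b} ha hb x hx => by
      rw [add_mul, mul_add, (ha x hx).1, (ha x hx).2, (hb x hx).1, (hb x hx).2]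
      exact ⟨add_zero 0, add_zero 0⟩)
    (fun {a} ha x hx => by
      rw [neg_mul, mul_neg, (ha x hx).1, (ha x hx).2]
      exact ⟨neg_zero, neg_zero⟩)
    (fun {b a} ha x hx => by
      refine ⟨by rw [mul_assoc, (ha x hx).1, mul_zero], ?_⟩
      rw [← mul_assoc]
      exact (ha (x * b) (I.mul_mem_right x b hx)).2)
    (fun {a b} ha x hx => by
      refine ⟨?_, by rw [← mul_assoc, (ha x hx).2, zero_mul]⟩
      rw [mul_assoc]
      exact (ha (b * x) (I.mul_mem_left b x hx)).1)

theorem TwoSidedIdeal.mem_ann {A : Type u} [NonUnitalRing A] {I : TwoSidedIdeal A} {a : A} :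
    a ∈ I.ann ↔ ∀ x ∈ I, a * x = 0 ∧ x * a = 0 :=
  TwoSidedIdeal.mem_mk' _ _ _ _ _ _ _

/-! Every vertex `v` is, by repeated use of (CK2), a sum of terms `p p*` over paths `p` from `v`
that are long or end at a sink. For fixed `a`, once `p` is long enough, its edges absorb all ghost
edges of `a` and `a p` is a combination of real paths with the same range as `p`
(`exists_mul_path_mem_pathSpan`). So, modulo an ideal, `a` can be tested on such products
(`mul_vertex_mem_of_mul_path_mem`).

For `I(H') ⊆ Ann(I(H))`: if `u a p ≠ 0` with `p` a long path from `v`, then `u` and `v` both reach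
the range of `p`. A vertex of `H'` and a vertex of the hereditary set `H` have no common descendant,
so the corners between them vanish.

For `Ann(I(H)) ⊆ I(H')`: let `p` be a long path with range `x`. If `x ∈ H'`, then `p ∈ I(H')`.
Otherwise a path `k` leads from `x` into `H`, so `k ∈ I(H)` and `a p k = 0`. Right multiplication by
`k` is injective on real paths (`eq_zero_of_mul_path_eq_zero`), so `a p = 0`. Injectivity comes from
a representation in which distinct paths with a common range send a basis vector to distinct basis
vectors. -/

namespace DirectedGraph

variable {V : Type u} {E : Type v} {G : DirectedGraph V E}

/-! ### Reachability and the set `H'`. -/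

theorem Reaches.trans {u v w : V} (h : G.Reaches u v) (h' : G.Reaches v w) : G.Reaches u w :=
  Relation.ReflTransGen.trans h h'

theorem reaches_edge (e : E) : G.Reaches (G.s e) (G.r e) :=
  Relation.ReflTransGen.single ⟨e, rfl, rfl⟩

theorem hereditary_notConnecting (H : Set V) : G.Hereditary (G.notConnecting H) :=
  fun _ hv _ hvw ⟨x, hx, hwx⟩ => hv ⟨x, hx, hvw.trans hwx⟩

/-- A path from `v` into `H` either is trivial, and then heredity puts the ranges of all edges at
`v` in `H`, or begins with an edge whose range still connects to `H`. -/
theorem saturated_notConnecting {H : Set V} (hH : G.Hereditary H) :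
    G.Saturated (G.notConnecting H) := by
  rintro v ⟨-, e, rfl : G.s e = v⟩ h ⟨x, hx, hvx⟩
  rcases Relation.ReflTransGen.cases_head hvx with rfl | ⟨y, ⟨f, hf, rfl⟩, hy⟩
  · exact h e rfl ⟨G.r e, hH _ hx _ (reaches_edge e), Relation.ReflTransGen.refl⟩
  · exact h f hf ⟨x, hx, hy⟩

/-! ### Paths as lists of edges, and an encoding of edges in `ℕ`. -/

variable (G) in
/-- The source of the path with list of edges `l` and range `x`. -/
def pathSource : List E → V → V
  | [], x => x
  | e :: _, _ => G.s e

variable (G) in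
/-- The edges in `l` form a directed path with range `x`. -/
def IsPath : List E → V → Prop
  | [], _ => True
  | e :: l, x => G.r e = G.pathSource l x ∧ IsPath l x

theorem IsPath.reaches {l : List E} {x : V} (h : G.IsPath l x) :
    G.Reaches (G.pathSource l x) x := by
  induction l with
  | nil => exact Relation.ReflTransGen.refl
  | cons e l ih =>
    refine (reaches_edge e).trans ?_
    rw [h.1]
    exact ih h.2

theorem Reaches.exists_isPath {v x : V} (h : G.Reaches v x) :
    ∃ l, G.IsPath l x ∧ G.pathSource l x = v := by
  induction h using Relation.ReflTransGen.head_induction_on with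
  | refl => exact ⟨[], trivial, rfl⟩
  | head h _ ih =>
    obtain ⟨e, rfl, rfl⟩ := h
    obtain ⟨l, hl, hs⟩ := ih
    exact ⟨e :: l, ⟨hs.symm, hl⟩, rfl⟩

/-- In a row-finite graph, one can embed copies of `ℕ` indexed by the edges into copies of `ℕ`
indexed by the vertices so that the copy at a vertex which is not a sink is partitioned by the
copies of the edges it emits. -/
theorem RowFinite.exists_encoding (hG : G.RowFinite) : ∃ c : E → ℕ → ℕ,
    (∀ e f m n, G.s e = G.s f → c e m = c f n → e = f ∧ m = n) ∧
      ∀ f n, ∃ e m, G.s e = G.s f ∧ c e m = n := by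
  have key : ∀ v : V, ∃ c : E → ℕ → ℕ,
      (∀ e f m n, G.s e = v → G.s f = v → c e m = c f n → e = f ∧ m = n) ∧
        ∀ f n, G.s f = v → ∃ e m, G.s e = v ∧ c e m = n := by
    intro v
    by_cases hv : ∃ f, G.s f = v
    · obtain ⟨f, hf⟩ := hv
      have : Finite {e : E // G.s e = v} := hG v
      have : Nonempty {e : E // G.s e = v} := ⟨⟨f, hf⟩⟩
      -- Finitely many copies of `ℕ`, and at least one, form a countably infinite set. The value 0
      -- used below off the fibre over `v` plays no role.
      obtain ⟨φ⟩ : Nonempty ({e : E // G.s e = v} × ℕ ≃ ℕ) := nonempty_equiv_of_countable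
      classical
      refine ⟨fun e n => if h : G.s e = v then φ (⟨e, h⟩, n) else 0, ?_, ?_⟩
      · intro e f m n he hf h
        simpa [he, hf] using h
      · intro f n _
        refine ⟨(φ.symm n).1, (φ.symm n).2, (φ.symm n).1.2, ?_⟩
        dsimp only
        rw [dif_pos (φ.symm n).1.2]
        simp
    · exact ⟨fun _ _ => 0, fun e _ _ _ h => (hv ⟨e, h⟩).elim, fun f _ h => (hv ⟨f, h⟩).elim⟩
  choose c hc using key
  refine ⟨fun e => c (G.s e) e, fun e f m n h hmn => ?_, fun f n => ?_⟩
  · exact (hc (G.s e)).1 e f m n rfl h.symm (by simpa only [h] using hmn)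
  · obtain ⟨e, m, he, hm⟩ := (hc (G.s f)).2 f n rfl
    exact ⟨e, m, he, by simpa only [he] using hm⟩

end DirectedGraph

/-! ### Generators, relations and the universal property. -/

namespace LeavittPathAlgebra

open DirectedGraph

variable {K : Type w} [Field K] {V : Type u} {E : Type v} {G : DirectedGraph V E}

variable (K G) in
/-- The edge `e`, as an element of `L_K(E)`. -/
noncomputable def edge (e : E) : LeavittPathAlgebra K G := mk K G (LeavittFree.edge K e)

variable (K G) in
/-- The ghost edge `e*`, as an element of `L_K(E)`. -/
noncomputable def ghost (e : E) : LeavittPathAlgebra K G := mk K G (LeavittFree.ghost K e)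

theorem mk_add (x y : LeavittFree K V E) : mk K G (x + y) = mk K G x + mk K G y := rfl

theorem mk_mul (x y : LeavittFree K V E) : mk K G (x * y) = mk K G x * mk K G y := rfl

theorem mk_smul (c : K) (x : LeavittFree K V E) : mk K G (c • x) = c • mk K G x := rfl

theorem mk_zero : mk K G 0 = 0 := rfl

theorem mk_sum {ι : Type*} (t : Finset ι) (f : ι → LeavittFree K V E) :
    mk K G (∑ i ∈ t, f i) = ∑ i ∈ t, mk K G (f i) :=
  map_sum (⟨⟨mk K G, mk_zero⟩, mk_add⟩ : LeavittFree K V E →+ LeavittPathAlgebra K G) f t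

theorem mk_eq_of_rel {x y : LeavittFree K V E} (h : LeavittRel K G x y) : mk K G x = mk K G y :=
  Quotient.sound' (RingConGen.Rel.of _ _ ⟨1, x, y, h, (one_smul K x).symm, (one_smul K y).symm⟩)

theorem vertex_mul_self (v : V) : vertex K G v * vertex K G v = vertex K G v :=
  mk_eq_of_rel (.vertex_mul_self v)

theorem vertex_mul_of_ne {v w : V} (h : v ≠ w) : vertex K G v * vertex K G w = 0 :=
  mk_eq_of_rel (.vertex_mul_of_ne v w h)

theorem source_mul_edge (e : E) : vertex K G (G.s e) * edge K G e = edge K G e :=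
  mk_eq_of_rel (.source_mul_edge e)

theorem edge_mul_range (e : E) : edge K G e * vertex K G (G.r e) = edge K G e :=
  mk_eq_of_rel (.edge_mul_range e)

theorem ghost_mul_source (e : E) : ghost K G e * vertex K G (G.s e) = ghost K G e :=
  mk_eq_of_rel (.ghost_mul_source e)

theorem ghost_mul_edge_self (e : E) : ghost K G e * edge K G e = vertex K G (G.r e) :=
  mk_eq_of_rel (.ghost_mul_edge_self e)

theorem ghost_mul_edge_of_ne {e f : E} (h : e ≠ f) : ghost K G e * edge K G f = 0 :=
  mk_eq_of_rel (.ghost_mul_edge_of_ne e f h)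

theorem sum_edge_mul_ghost (v : V) (t : Finset E) (ht : ∀ e : E, e ∈ t ↔ G.s e = v)
    (hne : t.Nonempty) : ∑ e ∈ t, edge K G e * ghost K G e = vertex K G v :=
  (mk_sum t _).symm.trans (mk_eq_of_rel (.sum_edge_mul_ghost v t ht hne))

/-- A property of elements of `L_K(E)` holds if it holds for the generators and is closed under the
algebra operations. -/
theorem induction_on {p : LeavittPathAlgebra K G → Prop} (a : LeavittPathAlgebra K G)
    (vertex : ∀ v, p (vertex K G v)) (edge : ∀ e, p (edge K G e)) (ghost : ∀ e, p (ghost K G e))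
    (zero : p 0) (add : ∀ a b, p a → p b → p (a + b)) (smul : ∀ (c : K) a, p a → p (c • a))
    (mul : ∀ a b, p a → p b → p (a * b)) : p a := by
  have hgen : ∀ x : LeavittGen V E, p (mk K G (LeavittFree.gen K x))
    | .vertex v => vertex v
    | .edge e => edge e
    | .ghost e => ghost e
  have hword : ∀ x : FreeSemigroup (LeavittGen V E), p (mk K G (MonoidAlgebra.single x 1)) := by
    intro x
    induction x using FreeSemigroup.recOnMul with
    | ih1 x => exact hgen x
    | ih2 x y hx hy =>
      have h : (MonoidAlgebra.single (FreeSemigroup.of x * y) 1 : LeavittFree K V E) =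
          MonoidAlgebra.single (FreeSemigroup.of x) 1 * MonoidAlgebra.single y 1 := by
        rw [MonoidAlgebra.single_mul_single, one_mul]
      rw [h, mk_mul]
      exact mul _ _ hx hy
  induction a using Quotient.inductionOn' with
  | h x =>
    change p (mk K G x)
    induction x using MonoidAlgebra.induction_linear with
    | zero => exact zero
    | add x y hx hy => exact add _ _ hx hy
    | single x c =>
      have h : (MonoidAlgebra.single x c : LeavittFree K V E) =
          c • MonoidAlgebra.single x 1 := by
        rw [MonoidAlgebra.smul_single, smul_eq_mul, mul_one]
      rw [h, mk_smul]
      exact smul _ _ (hword x)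

/-- The universal property of `L_K(E)`. -/
theorem exists_lift {A : Type*} [NonUnitalRing A] [Module K A] [IsScalarTower K A A]
    [SMulCommClass K A A] (p : V → A) (x y : E → A)
    (vertex_mul_self : ∀ v, p v * p v = p v)
    (vertex_mul_of_ne : ∀ v w, v ≠ w → p v * p w = 0)
    (source_mul_edge : ∀ e, p (G.s e) * x e = x e)
    (edge_mul_range : ∀ e, x e * p (G.r e) = x e)
    (range_mul_ghost : ∀ e, p (G.r e) * y e = y e)
    (ghost_mul_source : ∀ e, y e * p (G.s e) = y e)
    (ghost_mul_edge_self : ∀ e, y e * x e = p (G.r e))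
    (ghost_mul_edge_of_ne : ∀ e f, e ≠ f → y e * x f = 0)
    (sum_edge_mul_ghost : ∀ (v : V) (t : Finset E), (∀ e : E, e ∈ t ↔ G.s e = v) → t.Nonempty →
      ∑ e ∈ t, x e * y e = p v) :
    ∃ φ : LeavittPathAlgebra K G →ₙₐ[K] A,
      (∀ v, φ (vertex K G v) = p v) ∧ ∀ e, φ (edge K G e) = x e := by
  let g : LeavittGen V E → A := fun z => match z with
    | .vertex v => p v
    | .edge e => x e
    | .ghost e => y e
  let ψ : LeavittFree K V E →ₙₐ[K] A := MonoidAlgebra.liftMagma K (FreeSemigroup.lift g)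
  have hgen : ∀ z, ψ (LeavittFree.gen K z) = g z := by
    intro z
    simp [ψ, LeavittFree.gen]
  have hv : ∀ v, ψ (LeavittFree.vertex K v) = p v := fun v => hgen _
  have he : ∀ e, ψ (LeavittFree.edge K e) = x e := fun v => hgen _
  have hg : ∀ e, ψ (LeavittFree.ghost K e) = y e := fun v => hgen _
  have hrel : ∀ a b, LeavittRel K G a b → ψ a = ψ b := by
    intro a b h
    cases h <;> simp only [map_mul, map_sum, map_zero, hv, he, hg] <;> solve_by_elim
  have hcon : ∀ a b, leavittCon K G a b → ψ a = ψ b := by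
    intro a b h
    have h' : RingConGen.Rel (fun x y => ∃ (c : K) (a b : LeavittFree K V E),
      LeavittRel K G a b ∧ x = c • a ∧ y = c • b) a b := h
    clear h
    induction h' with
    | of x y h =>
      obtain ⟨d, a, b, hab, rfl, rfl⟩ := h
      rw [map_smul, map_smul, hrel a b hab]
    | refl x => rfl
    | symm _ ih => exact ih.symm
    | trans _ _ ih₁ ih₂ => exact ih₁.trans ih₂
    | add _ _ ih₁ ih₂ => rw [map_add, map_add, ih₁, ih₂]
    | mul _ _ ih₁ ih₂ => rw [map_mul, map_mul, ih₁, ih₂]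
  let φ : LeavittPathAlgebra K G → A := fun a => Quotient.liftOn' a ψ hcon
  refine ⟨{ toFun := φ, map_smul' := ?_, map_zero' := ?_, map_add' := ?_, map_mul' := ?_ }, hv, he⟩
  · intro c a
    induction a using Quotient.inductionOn' with
    | h a => exact map_smul ψ c a
  · exact map_zero ψ
  · intro a b
    induction a using Quotient.inductionOn' with
    | h a =>
      induction b using Quotient.inductionOn' with
      | h b => exact map_add ψ a b
  · intro a b
    induction a using Quotient.inductionOn' with
    | h a =>
      induction b using Quotient.inductionOn' with
      | h b => exact map_mul ψ a b

/-! ### A representation that separates paths. -/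

/-- The Leavitt path algebra of a row-finite graph acts on the vector space with basis `V × ℕ × ℤ`,
where `{v} × ℕ × ℤ` is the range of the vertex `v` and the last coordinate counts edges. -/
theorem exists_representation (hG : G.RowFinite) : ∃ c : E → ℕ → ℕ,
    (∀ e f m n, G.s e = G.s f → c e m = c f n → e = f ∧ m = n) ∧
    ∃ φ : LeavittPathAlgebra K G →ₙₐ[K] Module.End K (V × ℕ × ℤ →₀ K),
      (∀ v n k, φ (vertex K G v) (Finsupp.single (v, n, k) 1) = Finsupp.single (v, n, k) 1) ∧
      ∀ e n k, φ (edge K G e) (Finsupp.single (G.r e, n, k) 1) =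
        Finsupp.single (G.s e, c e n, k + 1) 1 := by
  classical
  obtain ⟨c, hinj, hsurj⟩ := hG.exists_encoding
  refine ⟨c, hinj, ?_⟩
  let op (f : V × ℕ × ℤ → V × ℕ × ℤ →₀ K) : Module.End K (V × ℕ × ℤ →₀ K) :=
    Finsupp.linearCombination K f
  have op_single : ∀ f x, op f (Finsupp.single x 1) = f x := fun f x => by simp [op]
  let p : V → Module.End K (V × ℕ × ℤ →₀ K) := fun u =>
    op fun x => if x.1 = u then Finsupp.single x 1 else 0
  let x : E → Module.End K (V × ℕ × ℤ →₀ K) := fun e =>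
    op fun x => if x.1 = G.r e then Finsupp.single (G.s e, c e x.2.1, x.2.2 + 1) 1 else 0
  -- The partial inverse of `x e`: the chosen index is unique by `hinj`, and basis vectors outside
  -- the image of `x e` go to 0.
  let y : E → Module.End K (V × ℕ × ℤ →₀ K) := fun e =>
    op fun x => if h : ∃ m, x.1 = G.s e ∧ c e m = x.2.1 then
      Finsupp.single (G.r e, h.choose, x.2.2 - 1) 1 else 0
  have p_self : ∀ v n k, p v (Finsupp.single (v, n, k) 1) = Finsupp.single (v, n, k) 1 :=
    fun v n k => by simp [p, op_single]
  have p_ne : ∀ v u n k, u ≠ v → p v (Finsupp.single (u, n, k) 1) = 0 :=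
    fun v u n k h => by simp [p, op_single, h]
  have x_self : ∀ e n k, x e (Finsupp.single (G.r e, n, k) 1) =
      Finsupp.single (G.s e, c e n, k + 1) 1 := fun v n k => by simp [x, op_single]
  have x_ne : ∀ e u n k, u ≠ G.r e → x e (Finsupp.single (u, n, k) 1) = 0 :=
    fun e u n k h => by simp [x, op_single, h]
  have y_self : ∀ e m k, y e (Finsupp.single (G.s e, c e m, k) 1) =
      Finsupp.single (G.r e, m, k - 1) 1 := by
    intro e m k
    have h : ∃ m', G.s e = G.s e ∧ c e m' = c e m := ⟨m, rfl, rfl⟩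
    refine (op_single _ _).trans ?_
    dsimp only
    rw [dif_pos h, (hinj e e _ _ rfl h.choose_spec.2).2]
  have y_ne : ∀ e u n k, (¬ ∃ m, u = G.s e ∧ c e m = n) →
      y e (Finsupp.single (u, n, k) 1) = 0 := by
    intro e u n k h
    simp only [y, op_single]
    rw [dif_neg h]
  have ext : ∀ f g : Module.End K (V × ℕ × ℤ →₀ K),
      (∀ v n k, f (Finsupp.single (v, n, k) 1) = g (Finsupp.single (v, n, k) 1)) → f = g := by
    intro f g h
    ext1 ⟨v, n, k⟩
    ext1
    exact h v n k
  refine (exists_lift (K := K) (G := G) p x y ?_ ?_ ?_ ?_ ?_ ?_ ?_ ?_ ?_).imp fun φ hφ =>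
    ⟨fun v n k => by rw [hφ.1, p_self], fun e n k => by rw [hφ.2, x_self]⟩
  · refine fun v => ext _ _ fun u n k => ?_
    rw [Module.End.mul_apply]
    by_cases h : u = v
    · subst h; rw [p_self, p_self]
    · rw [p_ne _ _ _ _ h, map_zero]
  · refine fun v w hvw => ext _ _ fun u n k => ?_
    rw [Module.End.mul_apply, LinearMap.zero_apply]
    by_cases h : u = w
    · subst h; rw [p_self, p_ne _ _ _ _ hvw.symm]
    · rw [p_ne _ _ _ _ h, map_zero]
  · refine fun e => ext _ _ fun u n k => ?_
    rw [Module.End.mul_apply]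
    by_cases h : u = G.r e
    · subst h; rw [x_self, p_self]
    · rw [x_ne _ _ _ _ h, map_zero]
  · refine fun e => ext _ _ fun u n k => ?_
    rw [Module.End.mul_apply]
    by_cases h : u = G.r e
    · subst h; rw [p_self]
    · rw [p_ne _ _ _ _ h, map_zero, x_ne _ _ _ _ h]
  · refine fun e => ext _ _ fun u n k => ?_
    rw [Module.End.mul_apply]
    by_cases h : ∃ m, u = G.s e ∧ c e m = n
    · obtain ⟨m, rfl, rfl⟩ := h; rw [y_self, p_self]
    · rw [y_ne _ _ _ _ h, map_zero]
  · refine fun e => ext _ _ fun u n k => ?_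
    rw [Module.End.mul_apply]
    by_cases h : u = G.s e
    · subst h; rw [p_self]
    · rw [p_ne _ _ _ _ h, map_zero, y_ne _ _ _ _ fun ⟨_, h', _⟩ => h h']
  · refine fun e => ext _ _ fun u n k => ?_
    rw [Module.End.mul_apply]
    by_cases h : u = G.r e
    · subst h; rw [x_self, y_self, p_self, add_sub_cancel_right]
    · rw [x_ne _ _ _ _ h, map_zero, p_ne _ _ _ _ h]
  · refine fun e f hef => ext _ _ fun u n k => ?_
    rw [Module.End.mul_apply, LinearMap.zero_apply]
    by_cases h : u = G.r f
    · subst h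
      rw [x_self, y_ne]
      rintro ⟨m, hs, hm⟩
      exact hef (hinj _ _ _ _ hs.symm hm).1
    · rw [x_ne _ _ _ _ h, map_zero]
  · refine fun v t ht ⟨f, hf⟩ => ext _ _ fun u n k => ?_
    simp only [LinearMap.sum_apply, Module.End.mul_apply]
    by_cases h : u = v
    -- Exactly one edge `e` at `v` has `n` in its copy of `ℕ`, so a single summand survives.
    · obtain ⟨e, m, he, rfl⟩ := hsurj f n
      rw [(ht f).1 hf] at he
      subst h he
      rw [Finset.sum_eq_single e, y_self, x_self, p_self, sub_add_cancel]
      · intro b _ hbe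
        rw [y_ne, map_zero]
        rintro ⟨m', hs, hm⟩
        exact hbe (hinj _ _ _ _ hs.symm hm).1
      · exact fun h => (h ((ht e).2 rfl)).elim
    · rw [p_ne _ _ _ _ h]
      refine Finset.sum_eq_zero fun e he => ?_
      rw [y_ne, map_zero]
      rintro ⟨m, hs, -⟩
      exact h (hs.trans ((ht e).1 he))

/-! ### Real paths in the algebra. -/

variable (K G) in
/-- The path with list of edges `l` and range `x`, as an element of `L_K(E)`. -/
noncomputable def path : List E → V → LeavittPathAlgebra K G
  | [], x => vertex K G x
  | e :: l, x => edge K G e * path l x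

theorem path_mul_range (l : List E) (x : V) : path K G l x * vertex K G x = path K G l x := by
  induction l with
  | nil => exact vertex_mul_self x
  | cons e l ih => rw [path, mul_assoc, ih]

theorem source_mul_path (l : List E) (x : V) :
    vertex K G (G.pathSource l x) * path K G l x = path K G l x := by
  cases l with
  | nil => exact vertex_mul_self x
  | cons e l => rw [path, pathSource, ← mul_assoc, source_mul_edge]

theorem vertex_mul_path_of_ne {v : V} {l : List E} {x : V} (h : v ≠ G.pathSource l x) :
    vertex K G v * path K G l x = 0 := by
  rw [← source_mul_path, ← mul_assoc, vertex_mul_of_ne h, zero_mul]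

theorem edge_mul_path_of_ne {e : E} {l : List E} {x : V} (h : G.r e ≠ G.pathSource l x) :
    edge K G e * path K G l x = 0 := by
  rw [← edge_mul_range, mul_assoc, vertex_mul_path_of_ne h, mul_zero]

variable (K G) in
/-- The span of the paths with range `x` that have length at least `m`, or any length if `x` is a
sink. -/
noncomputable def pathSpan (m : ℕ) (x : V) : Submodule K (LeavittPathAlgebra K G) :=
  Submodule.span K ((fun l => path K G l x) ''
    {l | G.IsPath l x ∧ (m ≤ l.length ∨ ∀ e, G.s e ≠ x)})

theorem path_mem_pathSpan {m : ℕ} {x : V} {l : List E} (hl : G.IsPath l x)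
    (h : m ≤ l.length ∨ ∀ e, G.s e ≠ x) : path K G l x ∈ pathSpan K G m x :=
  Submodule.subset_span ⟨l, ⟨hl, h⟩, rfl⟩

/-- Right multiplication by a path is injective on the span of the paths that end at its source. -/
theorem eq_zero_of_mul_path_eq_zero (hG : G.RowFinite) {m : ℕ} {z : LeavittPathAlgebra K G}
    {l : List E} {x : V} (hl : G.IsPath l x) (hz : z ∈ pathSpan K G m (G.pathSource l x))
    (h : z * path K G l x = 0) : z = 0 := by
  obtain ⟨c, hinj, φ, hv, he⟩ := exists_representation (K := K) hG
  let pos (l : List E) (n : ℕ) : ℕ := l.foldr c n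
  have hpath : ∀ l x n k, G.IsPath l x → φ (path K G l x) (Finsupp.single (x, n, k) 1) =
      Finsupp.single (G.pathSource l x, pos l n, k + l.length) 1 := by
    intro l x n k hl
    induction l with
    | nil => simpa [path, pathSource, pos] using hv x n k
    | cons e l ih =>
      rw [path, map_mul, Module.End.mul_apply, ih hl.2, ← hl.1, he]
      simp [pathSource, pos, add_assoc]
  -- Injectivity of `c` recovers the edges one at a time from the source onwards. Paths of different
  -- lengths may share a position; the `ℤ` coordinate tells them apart.
  have hpos : ∀ x n l l', G.IsPath l x → G.IsPath l' x → l.length = l'.length →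
      G.pathSource l x = G.pathSource l' x → pos l n = pos l' n → l = l' := by
    intro x n l
    induction l with
    | nil => exact fun l' _ _ h _ _ => (List.length_eq_zero_iff.1 h.symm).symm
    | cons e l ih =>
      rintro (_ | ⟨f, l'⟩) hl hl' hlen hs hp
      · simp at hlen
      · obtain ⟨rfl, h'⟩ := hinj e f (pos l n) (pos l' n) hs hp
        rw [ih l' hl.2 hl'.2 (by simpa using hlen) (hl.1.symm.trans hl'.1) h']
  set y := G.pathSource l x
  obtain ⟨d, hd, rfl⟩ := Finsupp.mem_span_image_iff_linearCombination K |>.1 hz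
  -- The test vector is the image of `(x, 0, 0)` under the path `l`. The paths occurring in `z` send
  -- it to distinct basis vectors, so each coefficient of `d` can be read off.
  have h0 : φ (Finsupp.linearCombination K (fun l => path K G l y) d)
      (Finsupp.single (y, pos l 0, 0 + (l.length : ℤ)) 1) = 0 := by
    rw [← hpath l x 0 0 hl, ← Module.End.mul_apply, ← map_mul, h, map_zero, LinearMap.zero_apply]
  have hd0 : d = 0 := by
    ext l₀
    by_cases hl₀ : l₀ ∈ d.support
    swap
    · simpa using hl₀
    have h1 := DFunLike.congr_fun h0 (G.pathSource l₀ y, pos l₀ (pos l 0),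
      0 + (l.length : ℤ) + l₀.length)
    rw [Finsupp.linearCombination_apply, Finsupp.sum, map_sum, LinearMap.sum_apply,
      Finsupp.finsetSum_apply, Finset.sum_eq_single l₀] at h1
    · rw [map_smul, LinearMap.smul_apply, hpath _ _ _ _ (hd hl₀).1] at h1
      simpa using h1
    · intro l₁ hl₁ hne
      rw [map_smul, LinearMap.smul_apply, hpath _ _ _ _ (hd hl₁).1, Finsupp.smul_apply,
        Finsupp.single_eq_of_ne, smul_zero]
      intro heq
      simp only [Prod.mk.injEq, add_right_inj, Nat.cast_inj] at heq
      exact hne (hpos y _ _ _ (hd hl₁).1 (hd hl₀).1 heq.2.2.symm heq.1.symm heq.2.1.symm)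
    · exact fun h => (h hl₀).elim
  rw [hd0, map_zero]

/-- For every `a ∈ L_K(E)`, right multiplication by a sufficiently long path turns `a` into a linear
combination of long paths without ghost edges. -/
theorem exists_mul_path_mem_pathSpan (a : LeavittPathAlgebra K G) : ∃ N : ℕ, ∀ m l x,
    G.IsPath l x → (m + N ≤ l.length ∨ ∀ e, G.s e ≠ x) →
      a * path K G l x ∈ pathSpan K G m x := by
  induction a using induction_on with
  | vertex v =>
    refine ⟨0, fun m l x hl hm => ?_⟩
    by_cases h : v = G.pathSource l x
    · rw [h, source_mul_path]
      exact path_mem_pathSpan hl hm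
    · rw [vertex_mul_path_of_ne h]
      exact zero_mem _
  | edge e =>
    refine ⟨0, fun m l x hl hm => ?_⟩
    by_cases h : G.r e = G.pathSource l x
    · exact path_mem_pathSpan (l := e :: l) ⟨h, hl⟩
        (hm.imp_left fun h => h.trans (Nat.le_succ l.length))
    · rw [edge_mul_path_of_ne h]
      exact zero_mem _
  | ghost e =>
    -- A ghost edge removes at most one edge. The empty path is admitted only at a sink, which is
    -- not the source of `e`, so there the product is 0.
    refine ⟨1, fun m l x hl hm => ?_⟩
    rcases l with _ | ⟨f, l⟩
    · have hx : G.s e ≠ x := by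
        rcases hm with hm | hm
        · simp at hm
        · exact hm e
      rw [path, ← ghost_mul_source, mul_assoc, vertex_mul_of_ne hx, mul_zero]
      exact zero_mem _
    · rw [path, ← mul_assoc]
      by_cases h : e = f
      · subst h
        rw [ghost_mul_edge_self, hl.1, source_mul_path]
        exact path_mem_pathSpan hl.2 (hm.imp_left Nat.le_of_succ_le_succ)
      · rw [ghost_mul_edge_of_ne h, zero_mul]
        exact zero_mem _
  | zero =>
    refine ⟨0, fun m l x _ _ => ?_⟩
    rw [zero_mul]
    exact zero_mem _
  | add a b iha ihb =>
    obtain ⟨M, hM⟩ := iha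
    obtain ⟨N, hN⟩ := ihb
    refine ⟨M + N, fun m l x hl hm => ?_⟩
    rw [add_mul]
    exact add_mem (hM m l x hl (hm.imp_left fun _ => by omega))
      (hN m l x hl (hm.imp_left fun _ => by omega))
  | smul c a ih =>
    obtain ⟨N, hN⟩ := ih
    refine ⟨N, fun m l x hl hm => ?_⟩
    rw [smul_mul_assoc]
    exact Submodule.smul_mem _ _ (hN m l x hl hm)
  | mul a b iha ihb =>
    obtain ⟨M, hM⟩ := iha
    obtain ⟨N, hN⟩ := ihb
    -- `b` uses up at most `N` edges, which leaves paths long enough for `a`. The range `x` does not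
    -- change, so the sink alternative persists.
    refine ⟨M + N, fun m l x hl hm => ?_⟩
    have hb : b * path K G l x ∈ pathSpan K G (m + M) x :=
      hN _ l x hl (hm.imp_left fun _ => by omega)
    have hle : pathSpan K G (m + M) x ≤ (pathSpan K G m x).comap (LinearMap.mulLeft K a) := by
      refine Submodule.span_le.2 ?_
      rintro _ ⟨l', ⟨hl', hm'⟩, rfl⟩
      exact hM m l' x hl' hm'
    rw [mul_assoc]
    exact hle hb

/-- Membership of `a * v` in a two-sided ideal can be tested on products of `a` with long paths
starting at `v`. -/
theorem mul_vertex_mem_of_mul_path_mem (hG : G.RowFinite)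
    {J : TwoSidedIdeal (LeavittPathAlgebra K G)} (n : ℕ) {a : LeavittPathAlgebra K G} {v : V}
    (h : ∀ l x, G.IsPath l x → G.pathSource l x = v → (n ≤ l.length ∨ ∀ e, G.s e ≠ x) →
      a * path K G l x ∈ J) :
    a * vertex K G v ∈ J := by
  induction n generalizing a v with
  | zero => exact h [] v trivial rfl (Or.inl le_rfl)
  | succ n ih =>
    by_cases hv : ∀ e, G.s e ≠ v
    · exact h [] v trivial rfl (Or.inr hv)
    push Not at hv
    obtain ⟨f, hf⟩ := hv
    -- (CK2) replaces `a v` by the sum of the `(a e) e*`. The ideal absorbs `e*`, and induction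
    -- applies to `a e` at the vertex `r(e)`, with paths one edge shorter.
    rw [← sum_edge_mul_ghost v (hG v).toFinset (fun e => by simp) ⟨f, by simpa using hf⟩,
      Finset.mul_sum]
    refine sum_mem fun e he => ?_
    rw [← mul_assoc]
    refine J.mul_mem_right _ _ ?_
    rw [← edge_mul_range, ← mul_assoc]
    refine ih fun l x hl hs hn => ?_
    rw [mul_assoc]
    exact h (e :: l) x ⟨hs.symm, hl⟩ (by simpa [pathSource] using he) (hn.imp_left Nat.succ_le_succ)

/-- Finite sums of vertices are right local units of `L_K(E)`. -/
theorem exists_mul_sum_vertex_eq (a : LeavittPathAlgebra K G) :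
    ∃ F : Finset V, ∀ F', F ⊆ F' → a * ∑ v ∈ F', vertex K G v = a := by
  classical
  have hvertex : ∀ (v : V) (F' : Finset V), {v} ⊆ F' →
      vertex K G v * ∑ u ∈ F', vertex K G u = vertex K G v := by
    intro v F' h
    rw [Finset.mul_sum, Finset.sum_eq_single v, vertex_mul_self]
    · exact fun u _ hu => vertex_mul_of_ne hu.symm
    · exact fun hv => (hv (h (Finset.mem_singleton_self v))).elim
  induction a using induction_on with
  | vertex v => exact ⟨{v}, hvertex v⟩
  | edge e =>
    refine ⟨{G.r e}, fun F' h => ?_⟩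
    rw [← edge_mul_range, mul_assoc, hvertex _ F' h]
  | ghost e =>
    refine ⟨{G.s e}, fun F' h => ?_⟩
    rw [← ghost_mul_source, mul_assoc, hvertex _ F' h]
  | zero => exact ⟨∅, fun _ _ => zero_mul _⟩
  | add a b iha ihb =>
    obtain ⟨A, hA⟩ := iha
    obtain ⟨B, hB⟩ := ihb
    refine ⟨A ∪ B, fun F' h => ?_⟩
    rw [add_mul, hA F' (Finset.union_subset_left h), hB F' (Finset.union_subset_right h)]
  | smul c a ih =>
    obtain ⟨A, hA⟩ := ih
    exact ⟨A, fun F' h => by rw [smul_mul_assoc, hA F' h]⟩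
  | mul a b _ ihb =>
    obtain ⟨B, hB⟩ := ihb
    exact ⟨B, fun F' h => by rw [mul_assoc, hB F' h]⟩

theorem mem_of_mul_vertex_mem {J : TwoSidedIdeal (LeavittPathAlgebra K G)}
    {a : LeavittPathAlgebra K G} (h : ∀ v, a * vertex K G v ∈ J) : a ∈ J := by
  obtain ⟨F, hF⟩ := exists_mul_sum_vertex_eq a
  rw [← hF F subset_rfl, Finset.mul_sum]
  exact sum_mem fun v _ => h v

/-! ### The two inclusions. -/

/-- The corner `u L_K(E) v` vanishes if `u` and `v` do not connect to a common vertex. -/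
theorem vertex_mul_mul_vertex_eq_zero (hG : G.RowFinite) {u v : V}
    (h : ∀ x, G.Reaches u x → ¬ G.Reaches v x) (a : LeavittPathAlgebra K G) :
    vertex K G u * a * vertex K G v = 0 := by
  obtain ⟨N, hN⟩ := exists_mul_path_mem_pathSpan a
  -- Vanishing is membership in the zero ideal, which makes the test on long paths available.
  rw [← TwoSidedIdeal.mem_bot]
  refine mul_vertex_mem_of_mul_path_mem hG N fun l x hl hs hn => ?_
  have hle : pathSpan K G 0 x ≤ LinearMap.ker (LinearMap.mulLeft K (vertex K G u)) := by
    refine Submodule.span_le.2 ?_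
    rintro _ ⟨l', ⟨hl', -⟩, rfl⟩
    refine vertex_mul_path_of_ne ?_
    rintro rfl
    exact h x hl'.reaches (hs ▸ hl.reaches)
  rw [TwoSidedIdeal.mem_bot, mul_assoc]
  exact hle (hN 0 l x hl (by rwa [zero_add]))

theorem vertex_mem_idealOf {H : Set V} {v : V} (hv : v ∈ H) : vertex K G v ∈ idealOf K G H :=
  TwoSidedIdeal.subset_span ⟨v, hv, rfl⟩

theorem path_mem_idealOf {H : Set V} {x : V} (hx : x ∈ H) (l : List E) :
    path K G l x ∈ idealOf K G H := by
  rw [← path_mul_range]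
  exact TwoSidedIdeal.mul_mem_left _ _ _ (vertex_mem_idealOf hx)

/-- For `v ∈ H'`, the elements `b` with `v L b = 0 = b L v` form a two-sided ideal; the arbitrary
middle factor makes it closed under multiplication. It contains `H` by the vanishing of corners,
hence contains `I(H)`. -/
theorem idealOf_notConnecting_le_ann (hG : G.RowFinite) {H : Set V} (hH : G.Hereditary H) :
    idealOf K G (G.notConnecting H) ≤ (idealOf K G H).ann := by
  refine TwoSidedIdeal.span_le.2 ?_
  rintro _ ⟨v, hv, rfl⟩
  have hdisj : ∀ w ∈ H, ∀ x, G.Reaches v x → ¬ G.Reaches w x :=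
    fun w hw x hvx hwx => hv ⟨x, hH w hw x hwx, hvx⟩
  have hle : idealOf K G H ≤ TwoSidedIdeal.mk'
      {b | ∀ a, vertex K G v * a * b = 0 ∧ b * a * vertex K G v = 0}
      (fun a => by simp) (fun {b c} hb hc a => by simp [mul_add, add_mul, hb a, hc a])
      (fun {b} hb a => by simp [hb a])
      (fun {c b} hb a => ⟨by rw [← mul_assoc, mul_assoc _ a c, (hb _).1],
        by rw [mul_assoc, mul_assoc, ← mul_assoc b, (hb a).2, mul_zero]⟩)
      (fun {b c} hb a => ⟨by rw [← mul_assoc, (hb a).1, zero_mul],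
        by rw [mul_assoc b, (hb _).2]⟩) := by
    refine TwoSidedIdeal.span_le.2 ?_
    rintro _ ⟨w, hw, rfl⟩
    refine (TwoSidedIdeal.mem_mk' _ _ _ _ _ _ _).2 fun a => ⟨?_, ?_⟩
    · exact vertex_mul_mul_vertex_eq_zero hG (hdisj w hw) a
    · exact vertex_mul_mul_vertex_eq_zero hG (fun x hwx hvx => hdisj w hw x hvx hwx) a
  refine TwoSidedIdeal.mem_ann.2 fun b hb => ?_
  have h := (TwoSidedIdeal.mem_mk' _ _ _ _ _ _ _).1 (hle hb) (vertex K G v)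
  rwa [vertex_mul_self, mul_assoc, vertex_mul_self] at h

/-- The products `a p` with long paths `p` are either 0, by cancelling a path from the range of `p`
into `H`, or lie in `I(H')` because `p` does. -/
theorem ann_idealOf_le (hG : G.RowFinite) (H : Set V) :
    (idealOf K G H).ann ≤ idealOf K G (G.notConnecting H) := by
  intro a ha
  obtain ⟨N, hN⟩ := exists_mul_path_mem_pathSpan a
  refine mem_of_mul_vertex_mem fun v => mul_vertex_mem_of_mul_path_mem hG N fun l x hl _ hn => ?_
  by_cases hx : G.ConnectsTo x H
  · obtain ⟨w, hw, hxw⟩ := hx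
    obtain ⟨k, hk, rfl⟩ := hxw.exists_isPath
    have h0 : a * path K G l (G.pathSource k w) * path K G k w = 0 := by
      rw [mul_assoc]
      exact (TwoSidedIdeal.mem_ann.1 ha _
        (TwoSidedIdeal.mul_mem_left _ _ _ (path_mem_idealOf hw k))).1
    -- Cancellation is legitimate because `p` is long enough for `a p` to be free of ghost edges.
    rw [eq_zero_of_mul_path_eq_zero hG hk (hN 0 l _ hl (by rwa [zero_add])) h0]
    exact zero_mem _
  · exact TwoSidedIdeal.mul_mem_left _ _ _ (path_mem_idealOf hx l)

end LeavittPathAlgebra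

theorem proposition3p2 (K : Type w) [Field K] {V : Type u} {E : Type v} (G : DirectedGraph V E)
    (hG : G.RowFinite) (H : Set V) (hH : G.Hereditary H) (hH' : G.Saturated H) :
    (G.Hereditary (G.notConnecting H) ∧ G.Saturated (G.notConnecting H)) ∧
      (LeavittPathAlgebra.idealOf K G H).ann =
        LeavittPathAlgebra.idealOf K G (G.notConnecting H) :=
  ⟨⟨DirectedGraph.hereditary_notConnecting H, DirectedGraph.saturated_notConnecting hH⟩,
    le_antisymm (LeavittPathAlgebra.ann_idealOf_le hG H)
      (LeavittPathAlgebra.idealOf_notConnecting_le_ann hG hH)⟩
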